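/- **Corollary.** No 2D topological check family whose code distance grows as $\Omega(n^c)$ for some constant $c>0$ has good soundness. Precisely: for each $i\in\mathbb N$ let $\mathcal M_i=(M_{i,1},\dots,M_{i,m_i})$ be a finite list of pairwise commuting $n_i$-qubit Pauli operators (checks), possibly redundant, generating a stabiliser group $\mathcal S_i$ with $-1\notin\mathcal S_i$, and let $n_i\to\infty$. Let $\Pi_i$ be the orthogonal projector onto the space of states fixed by $\mathcal S_i$. The weight $\mathrm{wt}(P)$ of a Pauli operator $P$ is the number of qubits on which it acts nontrivially. Assume that the code encodes at least one logical qubit, so that its distance $d_i$, the minimum of $\mathrm{wt}(P)$ over all Pauli operators $P$ with $P\Pi_i=\Pi_iP$ that do not lie in $\mathcal S_i$ up to a phase, is defined. Suppose that: 1. the family is *2D topological*: there are constants $C,q,r$, independent of $i$, such that every check in $\mathcal M_i$ has weight at most $C$, every qubit is acted on nontrivially by at most $C$ checks of $\mathcal M_i$ (the LDPC property), and the qubits can be placed on the sites of a two-dimensional square lattice, with open or periodic boundary conditions in each direction, such that each site holds at most $q$ qubits and any two qubits in the support of one check differ by at most $r$ in each coordinate; 2. $d_i=\Omega(n_i^{\,c})$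 for some constant $c>0$. Then the family does not have *good soundness*, that is, there do **not** exist constants $a,b>0$ and a real polynomial $f$, independent of $i$, with $f(0)=0$ and $f$ monotonically increasing (in the weak sense) on the nonnegative integers, such that for every $i$ there is an integer $t_i\ge a\,n_i^{\,b}$ for which $\mathcal M_i$ is $(t_i,f)$-sound. Here $\mathcal M_i$ is $(t,f)$-sound if for every Pauli error $E$ whose syndrome $\sigma(E)\in\mathbb Z_2^{m_i}$ (with $\sigma(E)_j=1$ iff $EM_{i,j}=-M_{i,j}E$) has Hamming weight $x=|\sigma(E)|<t$, there is a Pauli operator $E^\star$ with $\sigma(E^\star)=\sigma(E)$ and $\mathrm{wt}(E^\star)\le f(x)$. -/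

import Mathlib

/-- The homomorphism `ZMod 2 → ZMod 4`, `a ↦ 2 a`; it converts a sign `(-1)^a` into `i^(2a)`. -/
def twice : ZMod 2 →+ ZMod 4 where
  toFun a := 2 * (a.val : ZMod 4)
  map_zero' := by decide
  map_add' := by decide

/-- The `n`-qubit Pauli group: `⟨k, x, z⟩` is the operator `i^k ∏ⱼ Xⱼ^(x j) ∏ⱼ Zⱼ^(z j)`. -/
@[ext] structure Pauli (n : ℕ) where
  phase : ZMod 4
  x : Fin n → ZMod 2
  z : Fin n → ZMod 2

namespace Pauli

variable {n : ℕ}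

instance : Mul (Pauli n) :=
  ⟨fun P Q => ⟨P.phase + Q.phase + twice (dotProduct P.z Q.x), P.x + Q.x, P.z + Q.z⟩⟩

instance : One (Pauli n) := ⟨⟨0, 0, 0⟩⟩

instance : Inv (Pauli n) := ⟨fun P => ⟨-P.phase + twice (dotProduct P.z P.x), -P.x, -P.z⟩⟩

theorem mul_def (P Q : Pauli n) :
    P * Q = ⟨P.phase + Q.phase + twice (dotProduct P.z Q.x), P.x + Q.x, P.z + Q.z⟩ := rfl

theorem one_def : (1 : Pauli n) = ⟨0, 0, 0⟩ := rfl

theorem inv_def (P : Pauli n) :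
    P⁻¹ = ⟨-P.phase + twice (dotProduct P.z P.x), -P.x, -P.z⟩ := rfl

instance : Group (Pauli n) := Group.ofLeftAxioms
  (by
    intro P Q R
    simp only [mul_def, add_dotProduct, dotProduct_add, map_add, add_assoc, mk.injEq, and_true]
    abel)
  (by intro P; simp [mul_def, one_def])
  (by
    intro P
    simp [mul_def, one_def, inv_def, ← map_add, CharTwo.add_self_eq_zero])

/-- The scalar `i^k`. -/
def scalar (n : ℕ) (k : ZMod 4) : Pauli n := ⟨k, 0, 0⟩

/-- The qubits on which a Pauli operator acts nontrivially. -/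
def support (P : Pauli n) : Finset (Fin n) := {j | P.x j ≠ 0 ∨ P.z j ≠ 0}

/-- The weight: the number of qubits on which the operator acts nontrivially. -/
def wt (P : Pauli n) : ℕ := P.support.card

/-- The matrix of a Pauli operator in the computational basis:
`i^k X^x Z^z |w⟩ = i^k (-1)^(z·w) |w + x⟩`. -/
noncomputable def mat (P : Pauli n) : Matrix (Fin n → ZMod 2) (Fin n → ZMod 2) ℂ :=
  fun v w => if v = w + P.x then Complex.I ^ P.phase.val * (-1) ^ (dotProduct P.z w).val else 0

end Pauli

/-- The Hilbert space of `n` qubits. -/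
abbrev QubitSpace (n : ℕ) := EuclideanSpace ℂ (Fin n → ZMod 2)

/-- A Pauli operator acting on the Hilbert space of `n` qubits. -/
noncomputable def Pauli.op {n : ℕ} (P : Pauli n) : QubitSpace n →L[ℂ] QubitSpace n :=
  Matrix.toEuclideanCLM (𝕜 := ℂ) P.mat

/-- A finite list of Pauli checks (repetitions and redundancy are allowed) on `n` qubits that
generates a stabiliser group: the checks commute and `-1` is not a product of them. -/
structure CheckSet (n : ℕ) where
  numChecks : ℕ
  check : Fin numChecks → Pauli n
  commute : ∀ i j, Commute (check i) (check j)
  neg_one_notMem : Pauli.scalar n 2 ∉ Subgroup.closure (Set.range check)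

namespace CheckSet

variable {n : ℕ}

/-- The stabiliser group generated by the checks. -/
def stabilizer (M : CheckSet n) : Subgroup (Pauli n) := Subgroup.closure (Set.range M.check)

/-- The code space: the states fixed by the stabiliser. -/
noncomputable def codeSpace (M : CheckSet n) : Submodule ℂ (QubitSpace n) where
  carrier := {ψ | ∀ S ∈ M.stabilizer, S.op ψ = ψ}
  zero_mem' := by intro S _; simp
  add_mem' := by intro a b ha hb S hS; rw [map_add, ha S hS, hb S hS]
  smul_mem' := by intro c a ha S hS; rw [map_smul, ha S hS]

/-- The orthogonal projector onto the code space. -/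
noncomputable def projector (M : CheckSet n) : QubitSpace n →L[ℂ] QubitSpace n :=
  M.codeSpace.starProjection

/-- A nontrivial logical Pauli operator: it commutes with the code projector, and it is not
in the stabiliser, even after multiplication by a phase. -/
def IsNontrivialLogical (M : CheckSet n) (P : Pauli n) : Prop :=
  Commute P.op M.projector ∧ ∀ k : ZMod 4, Pauli.scalar n k * P ∉ M.stabilizer

/-- `d` is the code distance, the least weight of a nontrivial logical Pauli operator.
In particular such an operator exists: the code stores at least one logical qubit. -/
def HasDistance (M : CheckSet n) (d : ℕ) : Prop :=
  IsLeast (Pauli.wt '' {P | M.IsNontrivialLogical P}) d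

open Classical in
/-- The syndrome of a Pauli error: entry `i` is `1` iff `E Mᵢ = - Mᵢ E`. -/
noncomputable def syndrome (M : CheckSet n) (E : Pauli n) : Fin M.numChecks → ZMod 2 :=
  fun i => if E * M.check i = Pauli.scalar n 2 * (M.check i * E) then 1 else 0

/-- `(t, f)`-soundness. -/
def IsSound (M : CheckSet n) (t : ℤ) (f : ℤ → ℝ) : Prop :=
  f 0 = 0 ∧ ∀ E : Pauli n, (hammingNorm (M.syndrome E) : ℤ) < t →
    ∃ E' : Pauli n, M.syndrome E' = M.syndrome E ∧
      (E'.wt : ℝ) ≤ f (hammingNorm (M.syndrome E))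

/-- The checks act on a square lattice: the qubits sit at sites of `ℤ/L₁ × ℤ/L₂`, with at most
`q` qubits at each site, and any two qubits in the support of one check differ by at most `r`
in each coordinate. Here `L₁ = 0` or `L₂ = 0` gives `ℤ`, so open boundary conditions in that
direction (only finitely many sites are occupied), and `L₁, L₂ > 0` give periodic ones. -/
def IsLocalOnLattice (M : CheckSet n) (q r : ℕ) : Prop :=
  ∃ (L₁ L₂ : ℕ) (pos : Fin n → ZMod L₁ × ZMod L₂),
    (∀ site, {a | pos a = site}.ncard ≤ q) ∧
    ∀ i, ∀ a ∈ (M.check i).support, ∀ b ∈ (M.check i).support,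
      ∃ u v : ℤ, |u| ≤ r ∧ |v| ≤ r ∧ pos b = pos a + ((u : ZMod L₁), (v : ZMod L₂))

end CheckSet

/-- Good soundness of a check family: every member is `(t, f)`-sound with `t ≥ a n^b` for some
constants `a, b > 0`, and with `f` a polynomial, independent of the member, that is monotonically
increasing (in the weak sense) on the nonnegative integers. -/
def HasGoodSoundness {n : ℕ → ℕ} (M : ∀ i, CheckSet (n i)) : Prop :=
  ∃ (a b : ℝ) (p : Polynomial ℝ), 0 < a ∧ 0 < b ∧ Monotone (fun x : ℕ => p.eval (x : ℝ)) ∧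
    ∀ i, ∃ t : ℤ, a * (n i : ℝ) ^ b ≤ t ∧ (M i).IsSound t (fun x => p.eval (x : ℝ))

/-- Low-density parity check families. -/
def IsLDPC {n : ℕ → ℕ} (M : ∀ i, CheckSet (n i)) : Prop :=
  ∃ C : ℕ, ∀ i, (∀ j, ((M i).check j).wt ≤ C) ∧
    ∀ a : Fin (n i), {j | a ∈ ((M i).check j).support}.ncard ≤ C

/-- Two-dimensional topological check families: LDPC families whose checks are geometrically local
on two-dimensional lattices, with range and density of qubits bounded uniformly in the family. -/
def IsTopological2D {n : ℕ → ℕ} (M : ∀ i, CheckSet (n i)) : Prop :=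
  IsLDPC M ∧ ∃ q r : ℕ, ∀ i, (M i).IsLocalOnLattice q r

/-! A local code on the lattice that stores a qubit has a nontrivial logical operator `v` on
boundedly many columns: a region that supports no nontrivial logical operator can be cleaned using
only the checks that meet it (`exists_cleaning`, `HasRange.exists_logical_on_strip`). Truncating `v`
to the rows below `j` violates only checks near the cut, or near the seam if the rows are periodic,
so the syndrome weight stays below a constant `K` (`HasRange.card_violated_le`). Once `t` exceeds
`K`, soundness turns each truncation into a logical operator by a correction of weight at most `f
K`. Consecutive corrected truncations differ on boundedly many qubits. If the distance exceeded that
bound, each difference would be a stabiliser, and sweeping from the empty truncation to all of `v`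
would make `v` a stabiliser. So the distance is bounded (`IsLocalOnLattice.distance_le`), against
its growth.

The sweep is linear algebra over `ZMod 2`, with phases forgotten. The bridge from the Hilbert space
definitions is `isNontrivialLogical_iff`: commuting with the code projector amounts to commuting
with every check, because the code space is nonzero. -/

/-! ### Symplectic vectors over `ZMod 2`. -/

/-- The binary symplectic representation of a Pauli operator modulo phases. -/
abbrev PauliVec (n : ℕ) := (Fin n → ZMod 2) × (Fin n → ZMod 2)

namespace PauliVec

variable {n : ℕ}

/-- The qubits on which a symplectic vector is nonzero. -/
def support (v : PauliVec n) : Finset (Fin n) := {j | v.1 j ≠ 0 ∨ v.2 j ≠ 0}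

theorem notMem_support {v : PauliVec n} {j : Fin n} :
    j ∉ support v ↔ v.1 j = 0 ∧ v.2 j = 0 := by
  simp [support]

theorem support_zero : support (0 : PauliVec n) = ∅ := by
  ext; simp [support]

theorem eq_zero_of_support_subset_empty {v : PauliVec n} (h : support v ⊆ ∅) : v = 0 := by
  have h' : ∀ j, v.1 j = 0 ∧ v.2 j = 0 := fun j => notMem_support.1 fun hj => by simpa using h hj
  ext j
  exacts [(h' j).1, (h' j).2]

theorem support_add (u v : PauliVec n) : support (u + v) ⊆ support u ∪ support v := by
  intro j hj
  by_contra h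
  rw [Finset.mem_union, not_or, notMem_support, notMem_support] at h
  exact notMem_support.2 (by simp [h]) hj

theorem support_smul (c : ZMod 2) (v : PauliVec n) : support (c • v) ⊆ support v := by
  intro j hj
  by_contra h
  rw [notMem_support] at h
  exact notMem_support.2 (by simp [h]) hj

theorem support_neg (v : PauliVec n) : support (-v) = support v := by
  ext; simp [support]

/-- The symplectic form, which records whether two Pauli operators commute. -/
def symp (n : ℕ) : LinearMap.BilinForm (ZMod 2) (PauliVec n) :=
  LinearMap.mk₂ (ZMod 2) (fun u v => dotProduct u.2 v.1 + dotProduct u.1 v.2)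
    (by intro u v w; simp only [Prod.fst_add, Prod.snd_add, add_dotProduct]; ring)
    (by intro c u v; simp only [Prod.smul_fst, Prod.smul_snd, smul_dotProduct, smul_add])
    (by intro u v w; simp only [Prod.fst_add, Prod.snd_add, dotProduct_add]; ring)
    (by intro c u v; simp only [Prod.smul_fst, Prod.smul_snd, dotProduct_smul, smul_add])

theorem symp_apply (u v : PauliVec n) :
    symp n u v = dotProduct u.2 v.1 + dotProduct u.1 v.2 := rfl

theorem symp_comm (u v : PauliVec n) : symp n u v = symp n v u := by
  rw [symp_apply, symp_apply, dotProduct_comm, dotProduct_comm u.1, add_comm]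

theorem exists_symp_eq (f : Module.Dual (ZMod 2) (PauliVec n)) :
    ∃ w, ∀ v, symp n w v = f v := by
  -- The form pairs `x` parts with `z` parts, so the values of `f` on the basis are entered
  -- crosswise.
  refine ⟨(fun j => f (0, Pi.single j 1), fun j => f (Pi.single j 1, 0)), fun v => ?_⟩
  have h1 : f (v.1, 0) = ∑ j, f (Pi.single j 1, 0) * v.1 j := by
    have := LinearMap.pi_apply_eq_sum_univ
      (f ∘ₗ LinearMap.inl (ZMod 2) (Fin n → ZMod 2) (Fin n → ZMod 2)) v.1
    simp only [LinearMap.comp_apply, LinearMap.inl_apply] at this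
    rw [this]
    refine Finset.sum_congr rfl fun j _ => ?_
    rw [smul_eq_mul, mul_comm]
    congr 3
    ext k
    simp [Pi.single_apply, eq_comm]
  have h2 : f (0, v.2) = ∑ j, f (0, Pi.single j 1) * v.2 j := by
    have := LinearMap.pi_apply_eq_sum_univ
      (f ∘ₗ LinearMap.inr (ZMod 2) (Fin n → ZMod 2) (Fin n → ZMod 2)) v.2
    simp only [LinearMap.comp_apply, LinearMap.inr_apply] at this
    rw [this]
    refine Finset.sum_congr rfl fun j _ => ?_
    rw [smul_eq_mul, mul_comm]
    congr 3
    ext k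
    simp [Pi.single_apply, eq_comm]
  have h3 : f v = f (v.1, 0) + f (0, v.2) := by rw [← map_add]; simp
  rw [h3, h1, h2]
  rfl

theorem exists_symp_ne_zero {v : PauliVec n} (hv : v ≠ 0) : ∃ w, symp n w v ≠ 0 := by
  obtain ⟨f, hf⟩ : ∃ f : Module.Dual (ZMod 2) (PauliVec n), f v ≠ 0 := by
    by_contra! h
    exact hv ((Module.forall_dual_apply_eq_zero_iff (ZMod 2) v).1 h)
  obtain ⟨w, hw⟩ := exists_symp_eq f
  exact ⟨w, by rwa [hw]⟩

/-- Restriction of a symplectic vector to a set of qubits. -/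
def res (A : Finset (Fin n)) : PauliVec n →ₗ[ZMod 2] PauliVec n where
  toFun v := (fun j => if j ∈ A then v.1 j else 0, fun j => if j ∈ A then v.2 j else 0)
  map_add' u v := by ext j <;> by_cases h : j ∈ A <;> simp [h]
  map_smul' c v := by ext j <;> by_cases h : j ∈ A <;> simp [h]

theorem support_res (A : Finset (Fin n)) (v : PauliVec n) :
    support (res A v) = A ∩ support v := by
  ext j; by_cases h : j ∈ A <;> simp [support, res, h]

theorem res_eq_zero_iff {A : Finset (Fin n)} {v : PauliVec n} :
    res A v = 0 ↔ Disjoint A (support v) := by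
  rw [Finset.disjoint_iff_inter_eq_empty, ← support_res]
  exact ⟨fun h => h ▸ support_zero, fun h => eq_zero_of_support_subset_empty h.subset⟩

theorem res_eq_self {A : Finset (Fin n)} {v : PauliVec n} (h : support v ⊆ A) :
    res A v = v := by
  have h' : ∀ j, j ∉ A → v.1 j = 0 ∧ v.2 j = 0 := fun j hj => notMem_support.1 fun k => hj (h k)
  ext j <;> by_cases hj : j ∈ A <;> simp [res, hj, h']

theorem symp_res (A : Finset (Fin n)) (u v : PauliVec n) :
    symp n (res A u) v = symp n u (res A v) := by
  simp [symp_apply, res, dotProduct]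

theorem symp_eq_zero_of_disjoint {u v : PauliVec n} (h : Disjoint (support u) (support v)) :
    symp n u v = 0 := by
  rw [← res_eq_self (subset_refl (support u)), symp_res, res_eq_zero_iff.2 h, map_zero]

end PauliVec

open PauliVec

/-! ### Commutation of Pauli operators through the symplectic form. -/

namespace Pauli

variable {n : ℕ}

/-- The symplectic vector of a Pauli operator. -/
def vec (P : Pauli n) : PauliVec n := (P.x, P.z)

theorem vec_inv (P : Pauli n) : P⁻¹.vec = -P.vec := rfl

theorem eq_scalar_of_vec_eq_zero {P : Pauli n} (h : P.vec = 0) : P = scalar n P.phase :=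
  Pauli.ext rfl (congrArg Prod.fst h) (congrArg Prod.snd h)

theorem scalar_mul_scalar (k l : ZMod 4) : scalar n k * scalar n l = scalar n (k + l) := by
  simp [mul_def, scalar]

theorem scalar_zero : scalar n 0 = 1 := rfl

theorem scalar_mul (k : ZMod 4) (P : Pauli n) :
    scalar n k * P = ⟨k + P.phase, P.x, P.z⟩ := by
  simp [mul_def, scalar]

theorem mul_comm_twist (P Q : Pauli n) :
    P * Q = scalar n (twice (symp n P.vec Q.vec)) * (Q * P) := by
  rw [scalar_mul, mul_def, mul_def, symp_apply]
  refine Pauli.ext ?_ (add_comm _ _) (add_comm _ _)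
  simp only [vec, map_add]
  rw [dotProduct_comm P.x]
  have : ∀ a : ZMod 2, twice a + twice a = 0 := by decide
  linear_combination (-1 : ZMod 4) * this (dotProduct Q.z P.x)

theorem scalar_mul_eq_iff {k l : ZMod 4} {P : Pauli n} :
    scalar n k * P = scalar n l * P ↔ k = l := by
  simp [scalar, Pauli.ext_iff]

theorem commute_iff_symp {P Q : Pauli n} : Commute P Q ↔ symp n P.vec Q.vec = 0 := by
  have h : ∀ a : ZMod 2, twice a = 0 ↔ a = 0 := by decide
  rw [commute_iff_eq, mul_comm_twist P Q, ← h, ← scalar_mul_eq_iff (P := Q * P), scalar_zero,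
    one_mul]

theorem anticommute_iff_symp {P Q : Pauli n} :
    P * Q = scalar n 2 * (Q * P) ↔ symp n P.vec Q.vec = 1 := by
  have h : ∀ a : ZMod 2, twice a = 2 ↔ a = 1 := by decide
  rw [mul_comm_twist P Q, scalar_mul_eq_iff, h]

end Pauli

/-! ### Stabilisers and logical operators modulo phase; the cleaning lemma. -/

namespace CheckSet

variable {n : ℕ} (M : CheckSet n)

/-- The span of the symplectic vectors of the checks. -/
def stabSpan : Submodule (ZMod 2) (PauliVec n) :=
  Submodule.span (ZMod 2) (Set.range fun i => (M.check i).vec)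

/-- The symplectic vectors of the operators that commute with all checks. -/
def logicalSpace : Submodule (ZMod 2) (PauliVec n) where
  carrier := {v | ∀ i, symp n v (M.check i).vec = 0}
  zero_mem' := by intro i; simp
  add_mem' := by intro u v hu hv i; rw [map_add, LinearMap.add_apply, hu i, hv i, add_zero]
  smul_mem' := by intro c v hv i; rw [map_smul, LinearMap.smul_apply, hv i, smul_zero]

theorem symp_eq_zero {v s : PauliVec n} (hv : v ∈ M.logicalSpace) (hs : s ∈ M.stabSpan) :
    symp n v s = 0 := by
  have : M.stabSpan ≤ LinearMap.ker (symp n v) := by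
    rw [stabSpan, Submodule.span_le]
    rintro _ ⟨i, rfl⟩
    exact hv i
  exact this hs

theorem stabSpan_le_logicalSpace : M.stabSpan ≤ M.logicalSpace := by
  rw [stabSpan, Submodule.span_le]
  rintro _ ⟨i, rfl⟩ j
  exact Pauli.commute_iff_symp.1 (M.commute i j)

theorem vec_mem_stabSpan {P : Pauli n} (h : P ∈ M.stabilizer) : P.vec ∈ M.stabSpan := by
  induction h using Subgroup.closure_induction with
  | mem x hx =>
    obtain ⟨i, rfl⟩ := hx
    exact Submodule.subset_span ⟨i, rfl⟩
  | one => exact M.stabSpan.zero_mem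
  | mul x y _ _ hx hy => exact M.stabSpan.add_mem hx hy
  | inv x _ hx => exact M.stabSpan.neg_mem hx

theorem exists_stabilizer_vec {v : PauliVec n} (h : v ∈ M.stabSpan) :
    ∃ P ∈ M.stabilizer, P.vec = v := by
  induction h using Submodule.span_induction with
  | mem x hx =>
    obtain ⟨i, rfl⟩ := hx
    exact ⟨_, Subgroup.subset_closure ⟨i, rfl⟩, rfl⟩
  | zero => exact ⟨1, M.stabilizer.one_mem, rfl⟩
  | add x y _ _ hx hy =>
    obtain ⟨P, hP, rfl⟩ := hx
    obtain ⟨Q, hQ, rfl⟩ := hy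
    exact ⟨P * Q, M.stabilizer.mul_mem hP hQ, rfl⟩
  | smul c x _ hx =>
    obtain ⟨P, hP, rfl⟩ := hx
    obtain rfl | rfl : c = 0 ∨ c = 1 := by revert c; decide
    · exact ⟨1, M.stabilizer.one_mem, by rw [zero_smul]; rfl⟩
    · exact ⟨P, hP, (one_smul _ _).symm⟩

/-- Symplectic vectors forget exactly the phase, which matches triviality up to a phase in
`IsNontrivialLogical`. -/
theorem vec_mem_stabSpan_iff {P : Pauli n} :
    P.vec ∈ M.stabSpan ↔ ∃ k, Pauli.scalar n k * P ∈ M.stabilizer := by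
  constructor
  · intro h
    obtain ⟨Q, hQ, hQP⟩ := M.exists_stabilizer_vec h
    refine ⟨Q.phase - P.phase, ?_⟩
    rw [Pauli.scalar_mul]
    convert hQ using 1
    exact Pauli.ext (by simp) (congrArg Prod.fst hQP).symm (congrArg Prod.snd hQP).symm
  · rintro ⟨k, hk⟩
    have := M.vec_mem_stabSpan hk
    rwa [Pauli.scalar_mul] at this

theorem syndrome_eq (E : Pauli n) (i : Fin M.numChecks) :
    M.syndrome E i = symp n E.vec (M.check i).vec := by
  have h : ∀ a : ZMod 2, a = 0 ∨ a = 1 := by decide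
  rcases h (symp n E.vec (M.check i).vec) with h | h <;>
    simp [syndrome, Pauli.anticommute_iff_symp, h]

/-- The **cleaning lemma**: if every logical operator supported on `A` is trivial, then each
logical operator can be made to act trivially on `A` by multiplication with checks meeting `A`. -/
theorem exists_cleaning {A : Finset (Fin n)}
    (hA : ∀ v ∈ M.logicalSpace, support v ⊆ A → v ∈ M.stabSpan)
    {v : PauliVec n} (hv : v ∈ M.logicalSpace) :
    ∃ s ∈ Submodule.span (ZMod 2)
      ((fun i => (M.check i).vec) '' {i | ¬ Disjoint A (M.check i).support}),
      Disjoint A (support (v - s)) := by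
  set U := Submodule.span (ZMod 2)
    ((fun i => (M.check i).vec) '' {i | ¬ Disjoint A (M.check i).support})
  -- It is enough to match `v` on `A`. If that fails, some functional kills the restrictions of the
  -- checks meeting `A` but not `res A v`. Written as pairing with `w`, it makes `res A w` a logical
  -- operator on `A`, hence a stabiliser, that pairs nontrivially with the logical `v`.
  suffices h : res A v ∈ U.map (res A) by
    obtain ⟨s, hs, hsv⟩ := h
    exact ⟨s, hs, res_eq_zero_iff.1 (by rw [map_sub, hsv, sub_self])⟩
  by_contra hn
  obtain ⟨f, hf, hfU⟩ := Submodule.exists_dual_map_eq_bot_of_notMem hn inferInstance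
  obtain ⟨w, hw⟩ := exists_symp_eq f
  have hlog : res A w ∈ M.logicalSpace := by
    intro i
    rw [symp_res, hw]
    by_cases hi : Disjoint A (M.check i).support
    · rw [res_eq_zero_iff.2 hi, map_zero]
    · have : f (res A (M.check i).vec) ∈ (U.map (res A)).map f :=
        Submodule.mem_map_of_mem (Submodule.mem_map_of_mem
          (Submodule.subset_span ⟨i, hi, rfl⟩))
      rwa [hfU, Submodule.mem_bot] at this
  have hw' := hA _ hlog (by rw [support_res]; exact Finset.inter_subset_left)
  have := M.symp_eq_zero hv hw'
  rw [symp_comm, symp_res, hw] at this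
  exact hf this

end CheckSet
-- Pauli matrices, the code space and its projector.
namespace Pauli

variable {n : ℕ}

theorem I_pow_val_add (a b : ZMod 4) :
    Complex.I ^ (a + b).val = Complex.I ^ a.val * Complex.I ^ b.val := by
  rw [← pow_add, ZMod.val_add, ← pow_eq_pow_mod _ Complex.I_pow_four]

theorem neg_one_pow_val_add (a b : ZMod 2) :
    (-1 : ℂ) ^ (a + b).val = (-1) ^ a.val * (-1) ^ b.val := by
  rw [← pow_add, ZMod.val_add, ← pow_eq_pow_mod _ (by norm_num)]

theorem I_pow_twice_val (a : ZMod 2) : Complex.I ^ (twice a).val = (-1) ^ a.val := by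
  have h : ∀ a : ZMod 2, (twice a).val = 2 * a.val := by decide
  rw [h, pow_mul, Complex.I_sq]

theorem mat_mul (P Q : Pauli n) : (P * Q).mat = P.mat * Q.mat := by
  ext v w
  rw [Matrix.mul_apply, Finset.sum_eq_single (w + Q.x)]
  · simp only [mat, mul_def, if_true]
    by_cases h : v = w + Q.x + P.x
    · rw [if_pos h, if_pos (by rw [h]; abel)]
      simp only [dotProduct_add, add_dotProduct, I_pow_val_add, neg_one_pow_val_add,
        I_pow_twice_val]
      ring
    · rw [if_neg h, if_neg (by intro h'; exact h (by rw [h']; abel)), zero_mul]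
  · intro u _ hu
    simp [mat, hu]
  · simp

theorem mat_scalar (k : ZMod 4) : (scalar n k).mat = Complex.I ^ k.val • 1 := by
  ext v w
  simp [mat, scalar, Matrix.one_apply]

theorem mat_one : (1 : Pauli n).mat = 1 := by
  rw [← scalar_zero, mat_scalar]; simp

theorem op_mul (P Q : Pauli n) : (P * Q).op = P.op * Q.op := by
  rw [op, mat_mul, map_mul]; rfl

theorem op_mul_apply (P Q : Pauli n) (ψ : QubitSpace n) : (P * Q).op ψ = P.op (Q.op ψ) := by
  rw [op_mul]; rfl

theorem op_one : (1 : Pauli n).op = 1 := by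
  rw [op, mat_one, map_one]

theorem op_scalar_two : (scalar n 2).op = -1 := by
  have h : (2 : ZMod 4).val = 2 := rfl
  rw [op, mat_scalar, h, Complex.I_sq, neg_one_smul, map_neg, map_one]

theorem mat_inv (P : Pauli n) : P⁻¹.mat = P.mat.conjTranspose := by
  ext v w
  have hI : Complex.I ^ (-P.phase).val = star (Complex.I ^ P.phase.val) := by
    have h1 := I_pow_val_add (-P.phase) P.phase
    rw [neg_add_cancel, ZMod.val_zero, pow_zero] at h1
    have h2 : star (Complex.I ^ P.phase.val) * Complex.I ^ P.phase.val = 1 := by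
      rw [star_pow, ← mul_pow]; simp
    exact mul_right_cancel₀ (pow_ne_zero _ Complex.I_ne_zero) (h1.symm.trans h2.symm)
  have hx : -P.x = P.x := by ext j; exact ZMod.neg_eq_self_mod_two _
  have hz : -P.z = P.z := by ext j; exact ZMod.neg_eq_self_mod_two _
  have hxx : P.x + P.x = 0 := by ext j; exact CharTwo.add_self_eq_zero _
  have hvw : v = w + P.x ↔ w = v + P.x := by
    constructor <;> intro h <;> rw [h, add_assoc, hxx, add_zero]
  simp only [Matrix.conjTranspose_apply, mat, inv_def, hx, hz]
  by_cases h : w = v + P.x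
  · rw [if_pos (hvw.2 h), if_pos h, h, I_pow_val_add, hI, I_pow_twice_val, dotProduct_add,
      neg_one_pow_val_add, star_mul']
    have hs : (-1 : ℂ) ^ (dotProduct P.z P.x).val * (-1) ^ (dotProduct P.z P.x).val = 1 := by
      rw [← mul_pow]; simp
    simp only [star_pow, star_neg, star_one]
    linear_combination (star Complex.I ^ P.phase.val * (-1) ^ (dotProduct P.z v).val) * hs
  · rw [if_neg (mt hvw.1 h), if_neg h, star_zero]

theorem adjoint_op (P : Pauli n) : ContinuousLinearMap.adjoint P.op = P⁻¹.op := by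
  rw [op, op, mat_inv, ← ContinuousLinearMap.star_eq_adjoint, ← map_star]
  rfl

/-- Some Pauli operator anticommutes with `P`; conjugating by it preserves the trace and turns `P`
into `-P`. -/
theorem trace_mat_eq_zero {P : Pauli n} (h : P.vec ≠ 0) : P.mat.trace = 0 := by
  obtain ⟨w, hw⟩ := exists_symp_ne_zero h
  have hw1 : symp n w P.vec = 1 := by
    have h01 : ∀ a : ZMod 2, a ≠ 0 → a = 1 := by decide
    exact h01 _ hw
  let Q : Pauli n := ⟨0, w.1, w.2⟩
  have hQ : Q * P = scalar n 2 * (P * Q) := anticommute_iff_symp.2 hw1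
  have hQP : Q * P * Q⁻¹ = scalar n 2 * P := by rw [hQ]; group
  have h1 : (Q * P * Q⁻¹).mat.trace = P.mat.trace := by
    rw [mat_mul, mat_mul, Matrix.trace_mul_cycle, ← mat_mul, inv_mul_cancel, mat_one, one_mul]
  have h2 : (2 : ZMod 4).val = 2 := rfl
  rw [hQP, mat_mul, mat_scalar, h2, Complex.I_sq, neg_one_smul, neg_one_mul,
    Matrix.trace_neg] at h1
  exact self_eq_neg.1 h1.symm

instance : Finite (Pauli n) :=
  Finite.of_injective (fun P : Pauli n => (P.phase, P.x, P.z)) fun P Q h => by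
    simp only [Prod.mk.injEq] at h
    exact Pauli.ext h.1 h.2.1 h.2.2

end Pauli

namespace CheckSet

variable {n : ℕ} (M : CheckSet n)

/-- Of the four scalars, `-1` is excluded by assumption, and `i` and `-i` because they square to
`-1`. -/
theorem eq_one_of_mem_stabilizer {P : Pauli n} (hP : P ∈ M.stabilizer) (h : P.vec = 0) :
    P = 1 := by
  rw [Pauli.eq_scalar_of_vec_eq_zero h] at hP ⊢
  have h2 := M.stabilizer.mul_mem hP hP
  rw [Pauli.scalar_mul_scalar] at h2
  have hk : ∀ k : ZMod 4, k = 0 ∨ k = 2 ∨ k + k = 2 := by decide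
  rcases hk P.phase with hk | hk | hk
  · rw [hk, Pauli.scalar_zero]
  · exact absurd (hk ▸ hP) M.neg_one_notMem
  · exact absurd (hk ▸ h2) M.neg_one_notMem

/-- In the sum of all stabiliser matrices only the identity contributes to the trace, so the sum is
nonzero; left multiplication by a stabiliser permutes its terms, so every vector in its image is a
code state. -/
theorem exists_codeSpace_ne_zero : ∃ ψ ∈ M.codeSpace, ψ ≠ 0 := by
  classical
  have := Fintype.ofFinite M.stabilizer
  set A : Matrix (Fin n → ZMod 2) (Fin n → ZMod 2) ℂ := ∑ S : M.stabilizer, S.1.mat with hA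
  have htr : A.trace ≠ 0 := by
    rw [hA, Matrix.trace_sum, Finset.sum_eq_single 1]
    · rw [Subgroup.coe_one, Pauli.mat_one, Matrix.trace_one]
      exact Nat.cast_ne_zero.2 Fintype.card_ne_zero
    · intro S _ hS
      exact Pauli.trace_mat_eq_zero fun h => hS (Subtype.ext (M.eq_one_of_mem_stabilizer S.2 h))
    · simp
  have hA0 : Matrix.toEuclideanCLM (𝕜 := ℂ) A ≠ 0 := by
    rw [Ne, EmbeddingLike.map_eq_zero_iff]
    rintro h
    rw [h, Matrix.trace_zero] at htr
    exact htr rfl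
  obtain ⟨φ, hφ⟩ : ∃ φ, Matrix.toEuclideanCLM (𝕜 := ℂ) A φ ≠ 0 := by
    by_contra! h
    exact hA0 (ContinuousLinearMap.ext h)
  refine ⟨_, fun T hT => ?_, hφ⟩
  have hTA : T.mat * A = A := by
    rw [hA, Finset.mul_sum]
    simp only [← Pauli.mat_mul]
    exact Fintype.sum_equiv (Equiv.mulLeft (⟨T, hT⟩ : M.stabilizer)) _ _ fun S => rfl
  rw [Pauli.op, ← mul_apply_eq_comp, ← map_mul, hTA]

theorem op_mem_codeSpace {P : Pauli n} (hP : P.vec ∈ M.logicalSpace) {ψ : QubitSpace n}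
    (hψ : ψ ∈ M.codeSpace) : P.op ψ ∈ M.codeSpace := by
  intro S hS
  have h : Commute P S := Pauli.commute_iff_symp.2 (M.symp_eq_zero hP (M.vec_mem_stabSpan hS))
  rw [← Pauli.op_mul_apply, ← h.eq, Pauli.op_mul_apply, hψ S hS]

/-- If `P` preserves the code space but anticommutes with a check, it maps a nonzero code state to a
vector that equals its own negative, which is impossible for invertible `P`. Conversely, if `P`
commutes with the checks, then `P` and its adjoint `P⁻¹` both preserve the code space, so `P`
commutes with the orthogonal projector. -/
theorem commute_projector_iff {P : Pauli n} :
    Commute P.op M.projector ↔ P.vec ∈ M.logicalSpace := by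
  constructor
  · intro h i
    obtain ⟨ψ, hψ, hψ0⟩ := M.exists_codeSpace_ne_zero
    have hPψ : P.op ψ ∈ M.codeSpace := by
      have h1 : P.op (M.projector ψ) = M.projector (P.op ψ) := congrArg (· ψ) h.eq
      rw [projector, Submodule.starProjection_eq_self_iff.2 hψ] at h1
      exact Submodule.starProjection_eq_self_iff.1 h1.symm
    by_contra hi
    have hi1 : symp n P.vec (M.check i).vec = 1 := by
      have h01 : ∀ a : ZMod 2, a ≠ 0 → a = 1 := by decide
      exact h01 _ hi
    have hiS : M.check i ∈ M.stabilizer := Subgroup.subset_closure ⟨i, rfl⟩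
    have h2 : (P * M.check i).op ψ = P.op ψ := by
      rw [Pauli.op_mul_apply, hψ _ hiS]
    rw [Pauli.anticommute_iff_symp.2 hi1, Pauli.op_mul_apply, Pauli.op_mul_apply, hPψ _ hiS,
      Pauli.op_scalar_two] at h2
    have h3 : P.op ψ = 0 := by
      have : (2 : ℂ) • P.op ψ = 0 := by
        rw [two_smul]
        nth_rw 1 [← h2]
        exact neg_add_cancel _
      exact (smul_eq_zero.1 this).resolve_left two_ne_zero
    have h4 : (P⁻¹ * P).op ψ = ψ := by rw [inv_mul_cancel, Pauli.op_one]; rfl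
    exact hψ0 (by rw [← h4, Pauli.op_mul_apply, h3, map_zero])
  · intro h
    have hinv : P⁻¹.vec ∈ M.logicalSpace := by
      rw [Pauli.vec_inv]; exact neg_mem h
    refine ContinuousLinearMap.ext fun ψ => ?_
    change P.op (M.codeSpace.starProjection ψ) = M.codeSpace.starProjection (P.op ψ)
    symm
    refine Submodule.eq_starProjection_of_mem_of_inner_eq_zero
      (M.op_mem_codeSpace h (Submodule.starProjection_apply_mem _ _)) fun w hw => ?_
    rw [← map_sub, ← ContinuousLinearMap.adjoint_inner_right, Pauli.adjoint_op]
    exact Submodule.starProjection_inner_eq_zero _ _ (M.op_mem_codeSpace hinv hw)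

theorem isNontrivialLogical_iff {P : Pauli n} :
    M.IsNontrivialLogical P ↔ P.vec ∈ M.logicalSpace ∧ P.vec ∉ M.stabSpan := by
  rw [IsNontrivialLogical, commute_projector_iff, vec_mem_stabSpan_iff, not_exists]

theorem HasDistance.exists_logical {M : CheckSet n} {d : ℕ} (h : M.HasDistance d) :
    ∃ v ∈ M.logicalSpace, v ∉ M.stabSpan := by
  obtain ⟨P, hP, -⟩ := h.1
  exact ⟨P.vec, M.isNontrivialLogical_iff.1 hP⟩

theorem HasDistance.mem_stabSpan {M : CheckSet n} {d : ℕ} (h : M.HasDistance d)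
    {v : PauliVec n} (hv : v ∈ M.logicalSpace) (hd : (support v).card < d) :
    v ∈ M.stabSpan := by
  by_contra hn
  exact hd.not_ge (h.2 ⟨⟨0, v.1, v.2⟩, M.isNontrivialLogical_iff.2 ⟨hv, hn⟩, rfl⟩)

end CheckSet

/-! ### Natural number coordinates on the lattice. -/

/-- Integer coordinates for points on a line or on a circle of circumference `L`: the image is
bounded by some `L'`, and points at distance at most `r` stay at distance at most `r`, possibly
around a circle of circumference `L'`. -/
theorem exists_nat_coordinate {n : ℕ} (L : ℕ) (p : Fin n → ZMod L) (r : ℕ) :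
    ∃ (L' : ℕ) (c : Fin n → ℕ), (∀ a, c a < L') ∧ (∀ a b, c a = c b → p a = p b) ∧
      ∀ a b, ∀ u : ℤ, |u| ≤ r → p b = p a + u → c a < c b →
        c b ≤ c a + r ∨ c a + L' ≤ c b + r := by
  rcases Nat.eq_zero_or_pos L with rfl | hL
  -- On a line, shifting by a lower bound gives natural numbers and the first alternative always
  -- holds, so `L'` only has to exceed all coordinates.
  · change Fin n → ℤ at p
    obtain ⟨m, hm⟩ := (Set.finite_range p).bddBelow
    have hm' : ∀ a, m ≤ p a := fun a => hm ⟨a, rfl⟩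
    obtain ⟨B, hB⟩ := (Set.finite_range fun a => (p a - m).toNat).bddAbove
    refine ⟨B + 1, fun a => (p a - m).toNat, fun a => Nat.lt_succ_of_le (hB ⟨a, rfl⟩),
      fun a b h => ?_, fun a b u hu h _ => Or.inl ?_⟩
    · have := hm' a
      have := hm' b
      have h' : (p a - m).toNat = (p b - m).toNat := h
      change (p a : ℤ) = p b
      omega
    · have := hm' a
      have := hm' b
      have h' : p b = p a + u := h
      have := abs_le.1 hu
      change (p b - m).toNat ≤ (p a - m).toNat + r
      omega
  · have : NeZero L := ⟨hL.ne'⟩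
    refine ⟨L, fun a => (p a).val, fun a => ZMod.val_lt _, fun a b h => ZMod.val_injective L h,
      fun a b u hu h hlt => ?_⟩
    have hdvd : (L : ℤ) ∣ (p b).val - (p a).val - u := by
      rw [← ZMod.intCast_zmod_eq_zero_iff_dvd]
      push_cast
      rw [ZMod.natCast_zmod_val, ZMod.natCast_zmod_val, h]
      ring
    obtain ⟨k, hk⟩ := hdvd
    change (p a).val < (p b).val at hlt
    change (p b).val ≤ (p a).val + r ∨ (p a).val + L ≤ (p b).val + r
    have hu' := abs_le.1 hu
    have hb := ZMod.val_lt (p b)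
    have ha := ZMod.val_lt (p a)
    -- A positive `k` means that the displacement `u` crosses the seam of the circle.
    rcases le_or_gt k 0 with hk0 | hk0
    · left
      have : (L : ℤ) * k ≤ 0 := mul_nonpos_of_nonneg_of_nonpos (by positivity) hk0
      omega
    · right
      have : (L : ℤ) ≤ L * k := le_mul_of_one_le_right (by positivity) hk0
      omega

namespace CheckSet

variable {n : ℕ} (M : CheckSet n)

/-- The checks have range at most `r` with respect to a coordinate `c` on a circle of
circumference `L`. -/
def HasRange (c : Fin n → ℕ) (L r : ℕ) : Prop :=
  ∀ i, ∀ a ∈ (M.check i).support, ∀ b ∈ (M.check i).support, c a < c b →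
    c b ≤ c a + r ∨ c a + L ≤ c b + r

variable {M}

theorem IsLocalOnLattice.exists_coordinates {q r : ℕ} (h : M.IsLocalOnLattice q r) :
    ∃ (L₁ L₂ : ℕ) (col row : Fin n → ℕ), (∀ a, col a < L₁) ∧ (∀ a, row a < L₂) ∧
      (∀ x y, ({a | col a = x ∧ row a = y} : Finset (Fin n)).card ≤ q) ∧
      M.HasRange col L₁ r ∧ M.HasRange row L₂ r := by
  obtain ⟨K₁, K₂, pos, hq, hr⟩ := h
  obtain ⟨L₁, col, hcol, hcol', hcolr⟩ := exists_nat_coordinate K₁ (fun a => (pos a).1) r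
  obtain ⟨L₂, row, hrow, hrow', hrowr⟩ := exists_nat_coordinate K₂ (fun a => (pos a).2) r
  refine ⟨L₁, L₂, col, row, hcol, hrow, fun x y => ?_, fun i a ha b hb => ?_,
    fun i a ha b hb => ?_⟩
  · rcases Finset.eq_empty_or_nonempty ({a | col a = x ∧ row a = y} : Finset (Fin n)) with
      h | ⟨a, ha⟩
    · simp [h]
    · refine le_trans ?_ (hq (pos a))
      rw [← Set.ncard_coe_finset]
      refine Set.ncard_le_ncard (fun b hb => ?_) (Set.toFinite _)
      simp only [Finset.coe_filter, Finset.mem_univ, true_and, Finset.mem_filter,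
        Set.mem_ofPred_eq] at ha hb ⊢
      exact Prod.ext (hcol' b a (hb.1.trans ha.1.symm)) (hrow' b a (hb.2.trans ha.2.symm))
  · obtain ⟨u, v, hu, hv, huv⟩ := hr i a ha b hb
    exact hcolr a b u hu (congrArg Prod.fst huv)
  · obtain ⟨u, v, hu, hv, huv⟩ := hr i a ha b hb
    exact hrowr a b v hv (congrArg Prod.snd huv)

/-- A code with checks of range `r` that stores a logical qubit has a nontrivial logical operator
supported on at most `2 * r + 1` columns. -/
theorem HasRange.exists_logical_on_strip {col : Fin n → ℕ} {L r : ℕ} (hcol : ∀ a, col a < L)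
    (hr : M.HasRange col L r) (hM : ∃ v ∈ M.logicalSpace, v ∉ M.stabSpan) :
    ∃ (Q : Finset ℕ), Q.card ≤ 2 * r + 1 ∧ ∃ v ∈ M.logicalSpace, v ∉ M.stabSpan ∧
      ∀ a ∈ support v, col a ∈ Q := by
  classical
  -- With `m` least, the columns below `m - 1` support no nontrivial logical operator and can be
  -- cleaned.
  have hex : ∃ m, ∃ v ∈ M.logicalSpace, v ∉ M.stabSpan ∧ ∀ a ∈ support v, col a < m := by
    obtain ⟨v, hv, hv'⟩ := hM
    exact ⟨L, v, hv, hv', fun a _ => hcol a⟩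
  obtain ⟨v, hv, hv', hvm⟩ := Nat.find_spec hex
  have hmin := fun k => Nat.find_min hex (m := k)
  generalize Nat.find hex = m at hvm hmin
  rcases Nat.eq_zero_or_pos m with rfl | hm
  · refine absurd ?_ hv'
    have : support v ⊆ ∅ := fun a ha => absurd (hvm a ha) (Nat.not_lt_zero _)
    rw [eq_zero_of_support_subset_empty this]
    exact zero_mem _
  have hA : ∀ w ∈ M.logicalSpace,
      support w ⊆ ({a | col a < m - 1} : Finset (Fin n)) → w ∈ M.stabSpan := by
    intro w hw hsupp
    by_contra hw'
    exact hmin (m - 1) (by omega) ⟨w, hw, hw', fun a ha => by simpa using hsupp ha⟩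
  have hsupp : ∀ s ∈ Submodule.span (ZMod 2) ((fun i => (M.check i).vec) ''
      {i | ¬ Disjoint ({a | col a < m - 1} : Finset (Fin n)) (M.check i).support}),
      ∀ a ∈ support s, m - 1 ≤ col a → col a < m + r ∨ L ≤ col a + r := by
    intro s hs
    induction hs using Submodule.span_induction with
    | mem x hx =>
      obtain ⟨i, hi, rfl⟩ := hx
      intro a ha hma
      obtain ⟨b, hb, hb'⟩ := Finset.not_disjoint_iff.1 hi
      have hb1 : col b < m - 1 := by simpa using hb
      rcases hr i b hb' a ha (by omega) with h | h <;> omega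
    | zero => simp [support_zero]
    | add x y hx hy hx' hy' =>
      intro a ha
      exact (Finset.mem_union.1 (support_add x y ha)).elim (hx' a) (hy' a)
    | smul c x hx hx' => exact fun a ha => hx' a (support_smul c x ha)
  obtain ⟨s, hs, hdis⟩ := M.exists_cleaning hA hv
  have hsM : s ∈ M.stabSpan := by
    refine Submodule.span_mono ?_ hs
    rintro _ ⟨i, -, rfl⟩
    exact ⟨i, rfl⟩
  -- After cleaning, `v` leaves only column `m - 1`, and `s` only columns within `r` of the cleaned
  -- region, to its right or across the seam; hence `(r + 1) + r` columns.
  refine ⟨Finset.Ico (m - 1) (m + r) ∪ Finset.Ico (L - r) L, ?_, v - s,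
    sub_mem hv (M.stabSpan_le_logicalSpace hsM), fun h => hv' ?_, fun a ha => ?_⟩
  · refine (Finset.card_union_le _ _).trans ?_
    simp only [Nat.card_Ico]
    omega
  · simpa using add_mem h hsM
  · have h1 : m - 1 ≤ col a := by
      by_contra hlt
      exact Finset.disjoint_left.1 hdis (Finset.mem_filter.2 ⟨Finset.mem_univ a, not_le.1 hlt⟩) ha
    have h2 := hcol a
    rw [Finset.mem_union, Finset.mem_Ico, Finset.mem_Ico]
    have h3 : a ∈ support v ∪ support s := by
      rw [sub_eq_add_neg] at ha
      have := support_add _ _ ha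
      rwa [support_neg] at this
    rcases Finset.mem_union.1 h3 with h | h
    · have := hvm a h
      omega
    · have := hsupp s hs a h h1
      omega

/-! ### Truncated logical operators and the sweep over the rows. -/

/-- The set of checks violated by an error. -/
def violated (M : CheckSet n) (v : PauliVec n) : Finset (Fin M.numChecks) :=
  {i | symp n v (M.check i).vec ≠ 0}

theorem hammingNorm_syndrome (E : Pauli n) :
    hammingNorm (M.syndrome E) = (M.violated E.vec).card := by
  simp only [hammingNorm, violated, syndrome_eq]

/-- Cutting a logical operator on few columns between two rows violates boundedly many checks. -/
theorem HasRange.card_violated_le {col row : Fin n → ℕ} {L q r C : ℕ} (hrow : ∀ a, row a < L)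
    (hq : ∀ x y, ({a | col a = x ∧ row a = y} : Finset (Fin n)).card ≤ q)
    (hr : M.HasRange row L r)
    (hC : ∀ a : Fin n, {j | a ∈ (M.check j).support}.ncard ≤ C)
    {Q : Finset ℕ} {v : PauliVec n} (hv : v ∈ M.logicalSpace)
    (hvQ : ∀ a ∈ support v, col a ∈ Q) (j : ℕ) :
    (M.violated (res {a | row a < j} v)).card ≤ q * (Q.card * (2 * r)) * C := by
  classical
  -- Rows below the cut from which a check can reach row `j` or higher: directly, or across the seam
  -- from the first `r` rows.
  set R := Finset.Ico (j - r) j ∪ Finset.range r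
  set T : Finset (Fin n) := {a | col a ∈ Q ∧ row a ∈ R} with hT
  have hTcard : T.card ≤ q * (Q.card * (2 * r)) := by
    have h1 : T.card ≤ q * (Q ×ˢ R).card := by
      refine Finset.card_le_mul_card_image_of_maps_to (f := fun a => (col a, row a)) ?_ q ?_
      · intro a ha
        simpa [hT] using ha
      · rintro ⟨x, y⟩ -
        refine (Finset.card_le_card fun a ha => ?_).trans (hq x y)
        simp only [Finset.mem_filter, Prod.mk.injEq] at ha
        simpa using ha.2
    have h2 : R.card ≤ 2 * r := by
      refine (Finset.card_union_le _ _).trans ?_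
      simp only [Nat.card_Ico, Finset.card_range]
      omega
    rw [Finset.card_product] at h1
    exact h1.trans (by gcongr)
  have hsub : M.violated (res {a | row a < j} v) ⊆
      T.biUnion fun a => {i | a ∈ (M.check i).support} := by
    intro i hi
    have hi' : symp n (res {a | row a < j} v) (M.check i).vec ≠ 0 := by
      simpa [violated] using hi
    have hlow : ¬ Disjoint (support (res {a | row a < j} v)) (M.check i).support :=
      fun h => hi' (symp_eq_zero_of_disjoint h)
    -- Since `v` commutes with the check, both halves of `v` violate it, so the check meets both.
    have hhigh : ¬ Disjoint (support (v - res {a | row a < j} v)) (M.check i).support := by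
      intro h
      have := symp_eq_zero_of_disjoint (v := (M.check i).vec) h
      rw [map_sub, LinearMap.sub_apply, hv i, zero_sub, neg_eq_zero] at this
      exact hi' this
    obtain ⟨a, ha, hai⟩ := Finset.not_disjoint_iff.1 hlow
    obtain ⟨b, hb, hbi⟩ := Finset.not_disjoint_iff.1 hhigh
    rw [support_res, Finset.mem_inter, Finset.mem_filter] at ha
    have hbj : j ≤ row b := by
      by_contra hlt
      refine notMem_support.2 ?_ hb
      simp [res, not_le.1 hlt]
    have hb' := hrow b
    rw [Finset.mem_biUnion]
    refine ⟨a, ?_, by simpa using hai⟩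
    simp only [hT, R, Finset.mem_filter, Finset.mem_univ, true_and, Finset.mem_union,
      Finset.mem_Ico, Finset.mem_range]
    refine ⟨hvQ a ha.2, ?_⟩
    have := hr i a hai b hbi (by omega)
    omega
  refine (Finset.card_le_card hsub).trans ?_
  refine (Finset.card_biUnion_le_card_mul _ _ C fun a _ => ?_).trans (by gcongr)
  rw [← Set.ncard_coe_finset]
  simpa using hC a

/-- If errors of bounded syndrome have corrections of bounded weight, a two-dimensional code
storing a logical qubit has bounded distance. -/
theorem IsLocalOnLattice.distance_le {q r C d F : ℕ} (hloc : M.IsLocalOnLattice q r)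
    (hC : ∀ a : Fin n, {j | a ∈ (M.check j).support}.ncard ≤ C)
    (hd : M.HasDistance d)
    (hF : ∀ v, (M.violated v).card ≤ q * ((2 * r + 1) * (2 * r)) * C →
      ∃ w, v + w ∈ M.logicalSpace ∧ (support w).card ≤ F) :
    d ≤ q * (2 * r + 1) + F + F := by
  classical
  by_contra! hlt
  obtain ⟨L₁, L₂, col, row, hcol, hrow, hq, hrcol, hrrow⟩ := hloc.exists_coordinates
  obtain ⟨Q, hQ, v, hv, hv', hvQ⟩ := hrcol.exists_logical_on_strip hcol hd.exists_logical
  -- Quantifying over every small correction `w` lets the induction accept whatever `w'` the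
  -- hypothesis `hF` supplies, and lets the sweep end with `w = 0`.
  have key : ∀ j w, res {a | row a < j} v + w ∈ M.logicalSpace → (support w).card ≤ F →
      res {a | row a < j} v + w ∈ M.stabSpan := by
    intro j
    induction j with
    | zero =>
      intro w hw hwF
      have h0 : res ({a | row a < 0} : Finset (Fin n)) v = 0 := by
        rw [res_eq_zero_iff]; simp
      rw [h0, zero_add] at hw ⊢
      exact hd.mem_stabSpan hw (by omega)
    | succ j ih =>
      intro w hw hwF
      obtain ⟨w', hw', hwF'⟩ := hF (res {a | row a < j} v)
        ((hrrow.card_violated_le hrow hq hC hv hvQ j).trans (by gcongr))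
      have hstep : res {a | row a < j + 1} v = res {a | row a < j} v + res {a | row a = j} v := by
        ext k <;> simp only [res, LinearMap.coe_mk, AddHom.coe_mk, Prod.fst_add, Prod.snd_add,
          Pi.add_apply, Finset.mem_filter, Finset.mem_univ, true_and] <;>
          grind
      have hcard : (support (res {a | row a = j} v)).card ≤ q * (2 * r + 1) := by
        refine le_trans ?_ (Nat.mul_le_mul_left q hQ)
        refine Finset.card_le_mul_card_image_of_maps_to (f := col) ?_ q ?_
        · intro a ha
          rw [support_res] at ha
          exact hvQ a (Finset.mem_inter.1 ha).2
        · intro x _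
          refine (Finset.card_le_card fun a ha => ?_).trans (hq x j)
          rw [Finset.mem_filter, support_res] at ha
          simpa [ha.2] using (Finset.mem_inter.1 ha.1).1
      -- Only one row of the strip and the two corrections survive in the difference, which is
      -- therefore lighter than `d`.
      have hdiff : res {a | row a < j + 1} v + w - (res {a | row a < j} v + w') =
          res {a | row a = j} v + w + -w' := by
        rw [hstep]; abel
      have hmem : res {a | row a = j} v + w + -w' ∈ M.stabSpan := by
        refine hd.mem_stabSpan (hdiff ▸ sub_mem hw hw') (lt_of_le_of_lt ?_ hlt)
        calc _ ≤ (support (res {a | row a = j} v + w)).card + (support (-w')).card :=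
              (Finset.card_le_card (support_add _ _)).trans (Finset.card_union_le _ _)
          _ ≤ (support (res {a | row a = j} v)).card + (support w).card + (support (-w')).card :=
              Nat.add_le_add_right
                ((Finset.card_le_card (support_add _ _)).trans (Finset.card_union_le _ _)) _
          _ ≤ q * (2 * r + 1) + F + F := by rw [support_neg]; omega
      rw [← hdiff] at hmem
      simpa using add_mem hmem (ih w' hw' hwF')
  have hfull : res ({a | row a < L₂} : Finset (Fin n)) v = v :=
    res_eq_self fun a _ => by simpa using hrow a
  have := key L₂ 0 (by rwa [hfull, add_zero]) (by simp [support_zero])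
  rw [hfull, add_zero] at this
  exact hv' this

/-- Equal syndromes cancel modulo 2, so the sum of error and correction is logical. Monotonicity
replaces the actual syndrome weight by the uniform `K`. -/
theorem IsSound.exists_correction {t : ℤ} {f : ℕ → ℝ} {g : ℤ → ℝ} (hfg : ∀ x : ℕ, g x = f x)
    (hf : Monotone f) (h : M.IsSound t g) {K : ℕ} (hK : (K : ℤ) < t) (v : PauliVec n)
    (hv : (M.violated v).card ≤ K) :
    ∃ w, v + w ∈ M.logicalSpace ∧ (support w).card ≤ ⌊f K⌋₊ := by
  let E : Pauli n := ⟨0, v.1, v.2⟩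
  have hE : hammingNorm (M.syndrome E) = (M.violated v).card := hammingNorm_syndrome E
  obtain ⟨E', hsyn, hwt⟩ := h.2 E (by rw [hE]; omega)
  refine ⟨E'.vec, fun i => ?_, Nat.le_floor ?_⟩
  · have := congrFun hsyn i
    rw [syndrome_eq, syndrome_eq] at this
    rw [map_add, LinearMap.add_apply, this]
    exact CharTwo.add_self_eq_zero _
  · rw [hfg, hE] at hwt
    exact hwt.trans (hf hv)

end CheckSet

theorem mainTheorem5 (n : ℕ → ℕ) (hn : Filter.Tendsto n Filter.atTop Filter.atTop)
    (M : ∀ i, CheckSet (n i)) (hM : IsTopological2D M)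
    (d : ℕ → ℕ) (hd : ∀ i, (M i).HasDistance (d i))
    (c : ℝ) (hc : 0 < c)
    (hgrow : (fun i => (n i : ℝ) ^ c) =O[Filter.atTop] fun i => (d i : ℝ)) :
    ¬ HasGoodSoundness M := by
  rintro ⟨a, b, p, ha, hb, hp, hsound⟩
  obtain ⟨⟨C, hC⟩, q, r, hloc⟩ := hM
  -- `K` bounds the syndrome weight of a cut and `D` the resulting distance; neither depends on `i`.
  set K := q * ((2 * r + 1) * (2 * r)) * C
  set D := q * (2 * r + 1) + ⌊p.eval (K : ℝ)⌋₊ + ⌊p.eval (K : ℝ)⌋₊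
  have hnR : Filter.Tendsto (fun i => (n i : ℝ)) Filter.atTop Filter.atTop :=
    tendsto_natCast_atTop_atTop.comp hn
  have h1 : ∀ᶠ i in Filter.atTop, (K : ℝ) < a * (n i : ℝ) ^ b :=
    (((tendsto_rpow_atTop hb).comp hnR).const_mul_atTop ha).eventually_gt_atTop _
  obtain ⟨B, hB⟩ := hgrow.bound
  -- The constant `B` comes without a sign, hence the absolute value.
  have h2 : ∀ᶠ i in Filter.atTop, |B| * D < (n i : ℝ) ^ c :=
    ((tendsto_rpow_atTop hc).comp hnR).eventually_gt_atTop _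
  obtain ⟨i, hi1, hi2, hi3⟩ := (h1.and (h2.and hB)).exists
  obtain ⟨t, ht, hs⟩ := hsound i
  have hKt : (K : ℤ) < t := by
    have : (K : ℝ) < t := hi1.trans_le ht
    exact_mod_cast this
  have hD : d i ≤ D := (hloc i).distance_le (hC i).2 (hd i)
    (hs.exists_correction (f := fun x => p.eval (x : ℝ)) (fun x => by simp) hp hKt)
  rw [Real.norm_of_nonneg (by positivity), Real.norm_of_nonneg (by positivity)] at hi3
  have h4 : B * d i ≤ |B| * D := by
    have : (d i : ℝ) ≤ D := by exact_mod_cast hD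
    exact mul_le_mul (le_abs_self B) this (by positivity) (abs_nonneg B)
  linarith
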